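/- Let $H\in(0,\tfrac12)$, $\lambda>0$ and $\sigma\neq0$. Let $B^H=(B^H_t)_{t\in\mathbb R}$ be a two-sided fractional Brownian motion with Hurst parameter $H$, i.e. a centred Gaussian process with almost surely continuous paths and $\mathbb E[B^H_sB^H_t]=\frac12\left(|s|^{2H}+|t|^{2H}-|t-s|^{2H}\right)$. Let $X$ be the stationary fractional Ornstein--Uhlenbeck process $$X_t=\sigma\int_{-\infty}^t e^{-\lambda(t-s)}\,dB^H_s ,\qquad t\in\mathbb R,$$ where the identity holds almost surely for each $t$ and the integral is a pathwise Young (Riemann--Stieltjes) integral, improper at $-\infty$. Let $r(t)=\mathrm{Cov}(X_0,X_t)$ be its covariance function. Then $r$ is twice continuously differentiable on $(0,\infty)$, and there are constants $0<T_0<T_1$, depending only on $H,\lambda,\sigma$, such that $$r''(T_0)=0,\qquad r''(t)>0\ \text{ for } t\in(0,T_0),\qquad r''(t)<0\ \text{ for } t\in(T_1,\infty).\tag{$*$}$$ Moreover, for all constants $0<T_0<T_1$ satisfying $(*)$ the following hold, the products of increments being integrable. (i) (Local negative correlation) For all real $s_0$ and all $s_0\le a<b\le c<d\le s_0+T_0$,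 $$\mathbb E\left[(X_b-X_a)(X_d-X_c)\right]\le 0 .$$ (ii) (Long-range positive correlation) For all real $a<b<c<d$ with $c-b>T_1$, $$\mathbb E\left[(X_b-X_a)(X_d-X_c)\right]\ge 0 .$$ -/

import Mathlib

open MeasureTheory ProbabilityTheory Set Filter Topology

universe u

/-- `B` is a two-sided fractional Brownian motion on `ℝ` with Hurst parameter `H` under `P`:
a centred Gaussian process with almost surely continuous paths and covariance
`(|s|^(2H) + |t|^(2H) - |t - s|^(2H)) / 2`. (In particular `B 0 = 0` almost surely.) -/
structure IsFractionalBrownianMotion {Ω : Type u} [MeasurableSpace Ω]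
    (H : ℝ) (B : ℝ → Ω → ℝ) (P : Measure Ω) : Prop where
  isGaussianProcess : IsGaussianProcess B P
  mean_eq_zero : ∀ t : ℝ, ∫ ω, B t ω ∂P = 0
  covariance_eq : ∀ s t : ℝ, ∫ ω, B s ω * B t ω ∂P =
    (|s| ^ (2 * H) + |t| ^ (2 * H) - |t - s| ^ (2 * H)) / 2
  continuous_paths : ∀ᵐ ω ∂P, Continuous fun t => B t ω

/-- The Young (Riemann-Stieltjes) integral `∫_a^b f dg`, for `a ≤ b`, exists and equals `I`:
the Riemann sums `∑ f (ξ i) * (g (τ (i + 1)) - g (τ i))` over all tagged partitions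
`a = τ 0 ≤ ξ 0 ≤ τ 1 ≤ ... ≤ τ n = b` converge to `I` as the mesh tends to zero. -/
def HasYoungIntegral (f g : ℝ → ℝ) (a b I : ℝ) : Prop :=
  ∀ ε > 0, ∃ δ > 0, ∀ (n : ℕ) (τ ξ : ℕ → ℝ), τ 0 = a → τ n = b →
    (∀ i < n, τ i ≤ ξ i ∧ ξ i ≤ τ (i + 1) ∧ τ (i + 1) - τ i < δ) →
    |(∑ i ∈ Finset.range n, f (ξ i) * (g (τ (i + 1)) - g (τ i))) - I| < ε

/-- The improper Young integral `∫_{-∞}^b f dg` exists and equals `I`: the integrals over all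
`[a, b]` exist and converge to `I` as `a → -∞`. -/
def HasImproperYoungIntegral (f g : ℝ → ℝ) (b I : ℝ) : Prop :=
  ∃ J : ℝ → ℝ, (∀ a < b, HasYoungIntegral f g a b (J a)) ∧ Tendsto J atBot (𝓝 I)

/-- `X` is the stationary fractional Ornstein-Uhlenbeck process
`X t = σ ∫_{-∞}^t exp (-lam (t - s)) dB s` driven by the fractional Brownian motion `B` with
Hurst parameter `H`; for each `t` the identity holds almost surely. -/
structure IsStationaryFOU {Ω : Type u} [MeasurableSpace Ω]
    (H lam σ : ℝ) (B X : ℝ → Ω → ℝ) (P : Measure Ω) : Prop where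
  isFBM : IsFractionalBrownianMotion H B P
  eq_integral : ∀ t : ℝ, ∀ᵐ ω ∂P, ∃ I : ℝ,
    HasImproperYoungIntegral (fun s => Real.exp (-lam * (t - s))) (fun s => B s ω) t I ∧
      X t ω = σ * I

/-- The covariance function `r t = Cov (X 0, X t)`. -/
noncomputable def covFun {Ω : Type u} [MeasurableSpace Ω]
    (X : ℝ → Ω → ℝ) (P : Measure Ω) (t : ℝ) : ℝ :=
  covariance (X 0) (X t) P

/-- The conditions that determine the thresholds `T₀ < T₁` of a covariance function `r`:
`r'' > 0` on `(0, T₀)`, `r'' (T₀) = 0`, and `r'' < 0` on `(T₁, ∞)`. -/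
structure IsThresholdPair (r : ℝ → ℝ) (T₀ T₁ : ℝ) : Prop where
  pos : 0 < T₀
  lt : T₀ < T₁
  deriv2_eq_zero : iteratedDeriv 2 r T₀ = 0
  deriv2_pos : ∀ t ∈ Ioo 0 T₀, 0 < iteratedDeriv 2 r t
  deriv2_neg : ∀ t ∈ Ioi T₁, iteratedDeriv 2 r t < 0

/-! Put `a = 2 * H`, so that `0 < a < 1`, and let `M x` be the mean of `|x + U| ^ a` for `U`
exponential of rate `lam` (`expMean`). Integration by parts turns the path integral into an
exponential average of increments of `B`, and averaging the covariance of `B` twice gives `r = σ ^ 2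
* fouCov`, an explicit combination of `M t`, `M (-t)` and `|t| ^ a` (`inner_ouVec_ouVec`,
`ae_eq_ouVec`).

Since `M' = lam * M - lam * |x| ^ a`, with `σ = 1` one gets `r'' = lam ^ 2 * r + a * (1 - a) / 2 * t
^ (a - 2)` for `t > 0`. Near `0` the power dominates the bounded `r`, so `r'' > 0`. For large `t`
let `y = r''` and `q = y' + lam * y`. In `q` the term `M (-t)` cancels, and `q' = lam * q + C * t ^
(a - 4)` with `C > 0`. As `exp (-lam * t) * q` tends to `0`, this equation run back from infinity
makes `q` negative of order `t ^ (a - 4)`. Then `y` is negative up to an exponentially small term,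
hence eventually negative.

The covariance of two increments is `r (d - b) + r (c - a) - r (c - b) - r (d - a)`. The arguments
form an inner and an outer pair with equal sums, so convexity of `r` on `[0, T₀]` gives (i) and
concavity on `(T₁, ∞)` gives (ii). -/

/-! ### Exponential averages of `|x + u| ^ a` -/

theorem abs_rpow_le_one_add_abs {a : ℝ} (ha0 : 0 ≤ a) (ha1 : a ≤ 1) (x : ℝ) :
    |x| ^ a ≤ 1 + |x| := by
  rcases le_total |x| 1 with h | h
  · have := Real.rpow_le_one (abs_nonneg x) h ha0
    linarith [abs_nonneg x]
  · have := Real.rpow_le_rpow_of_exponent_le h ha1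
    rw [Real.rpow_one] at this
    linarith

theorem continuous_abs_rpow {a : ℝ} (ha : 0 ≤ a) : Continuous fun x : ℝ => |x| ^ a :=
  continuous_abs.rpow_const fun _ => Or.inr ha

theorem integrableOn_exp_smul_of_le {E : Type*} [NormedAddCommGroup E] [NormedSpace ℝ E]
    {lam : ℝ} (hlam : 0 < lam) {f : ℝ → E} (hf : Continuous f) {A C : ℝ}
    (hle : ∀ u, 0 < u → ‖f u‖ ≤ A + C * u) :
    IntegrableOn (fun u => (lam * Real.exp (-lam * u)) • f u) (Ioi 0) := by
  have h0 : IntegrableOn (fun u : ℝ => Real.exp (-lam * u)) (Ioi 0) :=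
    integrableOn_exp_mul_Ioi (by linarith) 0
  have h1 : IntegrableOn (fun u : ℝ => u * Real.exp (-lam * u)) (Ioi 0) := by
    simpa using integrableOn_rpow_mul_exp_neg_mul_rpow (p := 1) (s := 1) (by norm_num)
      (by norm_num) hlam
  have h2 : IntegrableOn (fun u : ℝ => (lam * A) * Real.exp (-lam * u)
      + (lam * C) * (u * Real.exp (-lam * u))) (Ioi 0) := (h0.const_mul _).add (h1.const_mul _)
  refine Integrable.mono' h2 (by fun_prop) ?_
  filter_upwards [ae_restrict_mem measurableSet_Ioi] with u hu
  have hp : 0 < lam * Real.exp (-lam * u) := by positivity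
  rw [norm_smul, Real.norm_eq_abs, abs_of_pos hp]
  calc _ ≤ lam * Real.exp (-lam * u) * (A + C * u) :=
        mul_le_mul_of_nonneg_left (hle u hu) hp.le
    _ = _ := by ring

theorem integral_exp_density {lam : ℝ} (hlam : 0 < lam) :
    ∫ u in Ioi (0 : ℝ), lam * Real.exp (-lam * u) = 1 := by
  rw [integral_const_mul, integral_exp_mul_Ioi (by linarith)]
  simp [hlam.ne']

/-- The mean of `|x + U| ^ a` for an exponentially distributed `U` with rate `lam`. -/
noncomputable def expMean (lam a x : ℝ) : ℝ :=
  ∫ u in Ioi (0 : ℝ), lam * Real.exp (-lam * u) * |x + u| ^ a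

theorem integrableOn_exp_mul_abs_rpow {lam a : ℝ} (hlam : 0 < lam) (ha0 : 0 ≤ a) (ha1 : a ≤ 1)
    (x : ℝ) : IntegrableOn (fun u => lam * Real.exp (-lam * u) * |x + u| ^ a) (Ioi 0) := by
  refine integrableOn_exp_smul_of_le (A := 1 + |x|) (C := 1) hlam
    ((continuous_abs_rpow ha0).comp (continuous_const.add continuous_id)) fun u hu => ?_
  have h := abs_rpow_le_one_add_abs ha0 ha1 (x + u)
  have h' := abs_add_le x u
  rw [abs_of_pos hu] at h'
  rw [Real.norm_eq_abs]
  rw [abs_of_nonneg (by positivity)]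
  linarith

theorem integrableOn_Ioi_exp_mul_abs_rpow {lam a : ℝ} (hlam : 0 < lam) (ha0 : 0 ≤ a)
    (ha1 : a ≤ 1) (x : ℝ) : IntegrableOn (fun s => Real.exp (-lam * s) * |s| ^ a) (Ioi x) := by
  have h := (integrableOn_exp_mul_abs_rpow hlam ha0 ha1 x).const_mul
    (lam⁻¹ * Real.exp (-lam * x))
  have e := (measurePreserving_add_left volume x).integrableOn_comp_preimage
    (measurableEmbedding_addLeft x) (f := fun s => Real.exp (-lam * s) * |s| ^ a) (s := Ioi x)
  rw [← e]
  simp only [preimage_const_add_Ioi, sub_self]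
  refine h.congr (ae_of_all _ fun u => ?_)
  simp only [Function.comp]
  rw [mul_add, Real.exp_add]
  field_simp

/-- The substitution `s = x + u` moves `x` out of the integrand into a smooth prefactor and the
endpoint. Hence `expMean` is differentiable everywhere, although `|x| ^ a` is not differentiable at
`0`. -/
theorem expMean_eq (lam a x : ℝ) :
    expMean lam a x
      = lam * Real.exp (lam * x) * ∫ s in Ioi x, Real.exp (-lam * s) * |s| ^ a := by
  have e := (measurePreserving_add_left volume x).setIntegral_preimage_emb
    (measurableEmbedding_addLeft x) (fun s => Real.exp (-lam * s) * |s| ^ a) (Ioi x)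
  rw [← e, ← integral_const_mul]
  simp only [preimage_const_add_Ioi, sub_self, expMean]
  congr 1
  ext u
  have : Real.exp (lam * x) * Real.exp (-lam * (x + u)) = Real.exp (-lam * u) := by
    rw [← Real.exp_add]; ring_nf
  rw [← this]; ring

theorem hasDerivAt_expMean {lam a : ℝ} (hlam : 0 < lam) (ha0 : 0 ≤ a) (ha1 : a ≤ 1) (x : ℝ) :
    HasDerivAt (expMean lam a) (lam * expMean lam a x - lam * |x| ^ a) x := by
  have hi := integrableOn_Ioi_exp_mul_abs_rpow hlam ha0 ha1
  have hc : Continuous fun s : ℝ => Real.exp (-lam * s) * |s| ^ a :=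
    (by fun_prop : Continuous fun s : ℝ => Real.exp (-lam * s)).mul (continuous_abs_rpow ha0)
  have hF : HasDerivAt (fun y => ∫ s in Ioi y, Real.exp (-lam * s) * |s| ^ a)
      (-(Real.exp (-lam * x) * |x| ^ a)) x := by
    have h := (intervalIntegral.integral_hasDerivAt_right (hc.intervalIntegrable 0 x)
      hc.stronglyMeasurable.stronglyMeasurableAtFilter hc.continuousAt).const_sub
        (∫ s in Ioi 0, Real.exp (-lam * s) * |s| ^ a)
    refine h.congr_of_eventuallyEq (Eventually.of_forall fun y => ?_)
    have := intervalIntegral.integral_interval_add_Ioi (hi 0) (hi y)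
    rw [← this]; ring
  have hE : HasDerivAt (fun y => lam * Real.exp (lam * y)) (lam * (Real.exp (lam * x) * lam)) x := by
    have := (((hasDerivAt_id x).const_mul lam).exp).const_mul lam
    simpa using this
  have h := hE.mul hF
  have e : expMean lam a = (fun y => lam * Real.exp (lam * y)) *
      fun y => ∫ s in Ioi y, Real.exp (-lam * s) * |s| ^ a := funext fun y => expMean_eq lam a y
  rw [e]
  refine h.congr_deriv ?_
  have : Real.exp (lam * x) * Real.exp (-lam * x) = 1 := by
    rw [← Real.exp_add]; simp
  simp only [Pi.mul_apply]
  linear_combination (-lam * |x| ^ a) * this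

theorem continuous_expMean {lam a : ℝ} (hlam : 0 < lam) (ha0 : 0 ≤ a) (ha1 : a ≤ 1) :
    Continuous (expMean lam a) :=
  continuous_iff_continuousAt.2 fun x => (hasDerivAt_expMean hlam ha0 ha1 x).continuousAt

/-- The product is `lam` times the tail of a convergent integral. It supplies the condition at
infinity in `exists_fouForcing_le`. -/
theorem tendsto_exp_neg_mul_expMean {lam a : ℝ} (hlam : 0 < lam) (ha0 : 0 ≤ a) (ha1 : a ≤ 1) :
    Tendsto (fun x => Real.exp (-lam * x) * expMean lam a x) atTop (𝓝 0) := by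
  have hi := integrableOn_Ioi_exp_mul_abs_rpow hlam ha0 ha1
  have h := (intervalIntegral_tendsto_integral_Ioi 0 (hi 0) tendsto_id).const_sub
    (∫ s in Ioi 0, Real.exp (-lam * s) * |s| ^ a)
  have h2 := h.const_mul lam
  rw [sub_self, mul_zero] at h2
  refine h2.congr fun x => ?_
  have := intervalIntegral.integral_interval_add_Ioi (hi 0) (hi x)
  have e : Real.exp (-lam * x) * Real.exp (lam * x) = 1 := by
    rw [← Real.exp_add]; simp
  rw [expMean_eq, id, ← this]
  linear_combination (-lam * ∫ s in Ioi x, Real.exp (-lam * s) * |s| ^ a) * e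

theorem expMean_nonneg {lam a : ℝ} (hlam : 0 < lam) (x : ℝ) : 0 ≤ expMean lam a x :=
  setIntegral_nonneg measurableSet_Ioi fun u _ => by positivity

theorem expMean_le {lam a : ℝ} (hlam : 0 < lam) (ha0 : 0 ≤ a) (ha1 : a ≤ 1) (x : ℝ) :
    expMean lam a x ≤ expMean lam 1 0 + 1 + |x| := by
  have h1 : IntegrableOn (fun u => lam * Real.exp (-lam * u) * (1 + |x|)) (Ioi 0) :=
    (((integrableOn_exp_mul_Ioi (by linarith) 0).const_mul lam).mul_const _)
  have h2 := integrableOn_exp_mul_abs_rpow hlam zero_le_one le_rfl 0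
  have e : expMean lam 1 0 + 1 + |x| = ∫ u in Ioi (0 : ℝ),
      (lam * Real.exp (-lam * u) * (1 + |x|) + lam * Real.exp (-lam * u) * |0 + u| ^ (1 : ℝ)) := by
    rw [integral_add h1 h2, integral_mul_const, integral_exp_density hlam, expMean]; ring
  rw [e, expMean]
  refine setIntegral_mono_on (integrableOn_exp_mul_abs_rpow hlam ha0 ha1 x) (h1.add h2)
    measurableSet_Ioi fun u hu => ?_
  have h := abs_rpow_le_one_add_abs ha0 ha1 (x + u)
  have h' := abs_add_le x u
  rw [← mul_add]
  refine mul_le_mul_of_nonneg_left ?_ (by positivity)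
  rw [zero_add, Real.rpow_one]
  linarith

/-- The difference of two independent exponential variables has a symmetric Laplace law. -/
theorem integral_exp_mul_expMean_neg {lam a : ℝ} (hlam : 0 < lam) (ha0 : 0 ≤ a) (ha1 : a ≤ 1)
    (h : ℝ) :
    IntegrableOn (fun u => lam * Real.exp (-lam * u) * expMean lam a (-(h + u))) (Ioi 0) ∧
    ∫ u in Ioi (0 : ℝ), lam * Real.exp (-lam * u) * expMean lam a (-(h + u))
      = (expMean lam a h + expMean lam a (-h)) / 2 := by
  have hb : ∀ u, 0 < u → ‖expMean lam a (-(h + u))‖ ≤ (expMean lam 1 0 + 1 + |h|) + 1 * u := by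
    intro u hu
    have h1 := expMean_le hlam ha0 ha1 (-(h + u))
    have h2 := abs_add_le h u
    rw [abs_of_pos hu] at h2
    rw [abs_neg] at h1
    rw [Real.norm_eq_abs, abs_of_nonneg (expMean_nonneg hlam _)]
    linarith
  have hcont : Continuous fun u => expMean lam a (-(h + u)) :=
    (continuous_expMean hlam ha0 ha1).comp (by fun_prop)
  have hI : IntegrableOn (fun u => lam * Real.exp (-lam * u) * expMean lam a (-(h + u)))
      (Ioi 0) := integrableOn_exp_smul_of_le hlam hcont hb
  refine ⟨hI, ?_⟩
  have hK := integrableOn_exp_mul_abs_rpow hlam ha0 ha1 h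
  have hd : ∀ u ∈ Ici (0 : ℝ), HasDerivAt (fun u => Real.exp (-lam * u) * expMean lam a (-(h + u)))
      (-2 * (lam * Real.exp (-lam * u) * expMean lam a (-(h + u)))
        + lam * Real.exp (-lam * u) * |h + u| ^ a) u := by
    intro u _
    have h1 : HasDerivAt (fun u => Real.exp (-lam * u)) (Real.exp (-lam * u) * -lam) u := by
      simpa using ((hasDerivAt_id u).const_mul (-lam)).exp
    have h2 : HasDerivAt (fun u => -(h + u)) (-1) u := ((hasDerivAt_id u).const_add h).neg
    have h3 := h1.mul ((hasDerivAt_expMean hlam ha0 ha1 (-(h + u))).comp u h2)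
    rw [abs_neg] at h3
    refine h3.congr_deriv ?_
    simp only [Function.comp]
    ring
  have hlim : Tendsto (fun u => Real.exp (-lam * u) * expMean lam a (-(h + u))) atTop (𝓝 0) := by
    have e0 : Tendsto (fun u : ℝ => Real.exp (-lam * u)) atTop (𝓝 0) :=
      Real.tendsto_exp_atBot.comp (tendsto_id.const_mul_atTop_of_neg (by linarith))
    have e1 : Tendsto (fun u : ℝ => u * Real.exp (-lam * u)) atTop (𝓝 0) := by
      simpa using tendsto_rpow_mul_exp_neg_mul_atTop_nhds_zero 1 lam hlam
    have e2 := (e0.const_mul (expMean lam 1 0 + 1 + |h|)).add e1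
    rw [mul_zero, zero_add] at e2
    refine squeeze_zero' (Eventually.of_forall fun u =>
      mul_nonneg (Real.exp_pos _).le (expMean_nonneg hlam _)) ?_ e2
    filter_upwards [eventually_gt_atTop 0] with u hu
    have := hb u hu
    rw [Real.norm_eq_abs, abs_of_nonneg (expMean_nonneg hlam _)] at this
    have := mul_le_mul_of_nonneg_left this (Real.exp_pos (-lam * u)).le
    linarith
  -- Integrating the derivative, with value `0` at infinity, gives `-M (-h) = -2 * L + M h`, where
  -- `L` is the wanted integral.
  have key := integral_Ioi_of_hasDerivAt_of_tendsto' hd ((hI.const_mul (-2)).add hK) hlim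
  rw [integral_add (hI.const_mul (-2)) hK, integral_const_mul] at key
  simp only [mul_zero, Real.exp_zero, one_mul, add_zero] at key
  rw [show ∫ u in Ioi (0 : ℝ), lam * Real.exp (-lam * u) * |h + u| ^ a = expMean lam a h from rfl]
    at key
  linarith

/-! ### The covariance function and its derivatives -/

/-- The covariance function of the stationary fractional Ornstein-Uhlenbeck process with unit
noise intensity, in terms of `a = 2 * H`. -/
noncomputable def fouCov (lam a h : ℝ) : ℝ :=
  ((expMean lam a h + expMean lam a (-h)) / 2 - |h| ^ a) / 2

theorem continuous_fouCov {lam a : ℝ} (hlam : 0 < lam) (ha0 : 0 ≤ a) (ha1 : a ≤ 1) :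
    Continuous (fouCov lam a) := by
  have h := continuous_expMean hlam ha0 ha1
  exact (((h.add (h.comp continuous_neg)).div_const 2).sub (continuous_abs_rpow ha0)).div_const 2

theorem hasDerivAt_const_mul_rpow (c p : ℝ) {t : ℝ} (ht : 0 < t) :
    HasDerivAt (fun x : ℝ => c * x ^ p) (c * p * t ^ (p - 1)) t := by
  refine ((Real.hasDerivAt_rpow_const (Or.inl ht.ne')).const_mul c).congr_deriv ?_
  ring

theorem hasDerivAt_expMean_neg {lam a : ℝ} (hlam : 0 < lam) (ha0 : 0 ≤ a) (ha1 : a ≤ 1) {t : ℝ}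
    (ht : 0 < t) :
    HasDerivAt (fun x => expMean lam a (-x)) (lam * t ^ a - lam * expMean lam a (-t)) t := by
  have h := (hasDerivAt_expMean hlam ha0 ha1 (-t)).comp t (hasDerivAt_neg t)
  rw [abs_neg, abs_of_pos ht] at h
  refine h.congr_deriv ?_
  ring

/-- The derivative of `fouCov` on the positive half-line. -/
noncomputable def fouCovDeriv (lam a t : ℝ) : ℝ :=
  (lam / 2 * (expMean lam a t - expMean lam a (-t)) - a * t ^ (a - 1)) / 2

/-- The second derivative of `fouCov` on the positive half-line. -/
noncomputable def fouCovDeriv2 (lam a t : ℝ) : ℝ :=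
  lam ^ 2 * fouCov lam a t - a * (a - 1) / 2 * t ^ (a - 2)

section

variable {lam a : ℝ} (hlam : 0 < lam) (ha0 : 0 < a) (ha1 : a < 1) {t : ℝ} (ht : 0 < t)

include hlam ha0 ha1 ht

theorem hasDerivAt_fouCov : HasDerivAt (fouCov lam a) (fouCovDeriv lam a t) t := by
  have hM := hasDerivAt_expMean hlam ha0.le ha1.le t
  rw [abs_of_pos ht] at hM
  have hk := hasDerivAt_const_mul_rpow 1 a ht
  have h := (((hM.add (hasDerivAt_expMean_neg hlam ha0.le ha1.le ht)).div_const 2).sub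
    hk).div_const 2
  refine (h.congr_deriv ?_).congr_of_eventuallyEq ?_
  · simp only [fouCovDeriv]; ring
  · filter_upwards [lt_mem_nhds ht] with x hx
    simp [fouCov, abs_of_pos hx]

theorem hasDerivAt_fouCovDeriv : HasDerivAt (fouCovDeriv lam a) (fouCovDeriv2 lam a t) t := by
  have hM := hasDerivAt_expMean hlam ha0.le ha1.le t
  rw [abs_of_pos ht] at hM
  have h := (((hM.sub (hasDerivAt_expMean_neg hlam ha0.le ha1.le ht)).const_mul (lam / 2)).sub
    (hasDerivAt_const_mul_rpow a (a - 1) ht)).div_const 2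
  refine h.congr_deriv ?_
  simp only [fouCovDeriv2, fouCov, abs_of_pos ht]
  rw [show a - 1 - 1 = a - 2 by ring]
  ring

theorem hasDerivAt_fouCovDeriv2 : HasDerivAt (fouCovDeriv2 lam a)
    (lam ^ 2 * fouCovDeriv lam a t - a * (a - 1) / 2 * (a - 2) * t ^ (a - 3)) t := by
  have h := ((hasDerivAt_fouCov hlam ha0 ha1 ht).const_mul (lam ^ 2)).sub
    (hasDerivAt_const_mul_rpow (a * (a - 1) / 2) (a - 2) ht)
  rwa [show a - 2 - 1 = a - 3 by ring] at h

end

/-! ### Sign of the second derivative near zero and at infinity -/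

theorem continuousOn_fouCovDeriv2 {lam a : ℝ} (hlam : 0 < lam) (ha0 : 0 < a) (ha1 : a < 1) :
    ContinuousOn (fouCovDeriv2 lam a) (Ioi 0) := fun _ ht =>
  (hasDerivAt_fouCovDeriv2 hlam ha0 ha1 ht).continuousAt.continuousWithinAt

theorem eventually_fouCovDeriv2_pos {lam a : ℝ} (hlam : 0 < lam) (ha0 : 0 < a) (ha1 : a < 1) :
    ∀ᶠ t in 𝓝[>] 0, 0 < fouCovDeriv2 lam a t := by
  have h1 : Tendsto (fun t => lam ^ 2 * fouCov lam a t) (𝓝[>] 0) (𝓝 (lam ^ 2 * fouCov lam a 0)) :=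
    (((continuous_fouCov hlam ha0.le ha1.le).tendsto 0).mono_left nhdsWithin_le_nhds).const_mul _
  have h2 : Tendsto (fun t : ℝ => a * (1 - a) / 2 * t ^ (a - 2)) (𝓝[>] 0) atTop :=
    (tendsto_rpow_neg_nhdsGT_zero (by linarith)).const_mul_atTop
      (by have : 0 < 1 - a := by linarith
          positivity)
  filter_upwards [(tendsto_atTop_add_left_of_le' _ (lam ^ 2 * fouCov lam a 0 - 1)
    ((h1.eventually (lt_mem_nhds (sub_one_lt _))).mono fun _ h => h.le) h2).eventually_gt_atTop 0]
    with t ht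
  rw [fouCovDeriv2]
  linarith

/-- The forcing `q = y' + lam * y` of the linear equation of first order satisfied by
`y = fouCovDeriv2`. -/
noncomputable def fouForcing (lam a t : ℝ) : ℝ :=
  (lam ^ 3 * expMean lam a t - lam ^ 3 * t ^ a - lam ^ 2 * a * t ^ (a - 1)
    - lam * a * (a - 1) * t ^ (a - 2) - a * (a - 1) * (a - 2) * t ^ (a - 3)) / 2

theorem fouForcing_eq {lam a t : ℝ} (ht : 0 < t) :
    lam ^ 2 * fouCovDeriv lam a t - a * (a - 1) / 2 * (a - 2) * t ^ (a - 3)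
      = fouForcing lam a t - lam * fouCovDeriv2 lam a t := by
  simp only [fouCovDeriv, fouForcing, fouCovDeriv2, fouCov, abs_of_pos ht]
  ring

/-- Each power in `fouForcing` is chosen by the previous one: its `lam` multiple cancels the
derivative of the term before it, and only the derivative of the last power survives. -/
theorem hasDerivAt_fouForcing {lam a t : ℝ} (hlam : 0 < lam) (ha0 : 0 < a) (ha1 : a < 1)
    (ht : 0 < t) : HasDerivAt (fouForcing lam a)
      (lam * fouForcing lam a t + a * (1 - a) * (2 - a) * (3 - a) / 2 * t ^ (a - 4)) t := by
  have hM := hasDerivAt_expMean hlam ha0.le ha1.le t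
  rw [abs_of_pos ht] at hM
  have h := (((((hM.const_mul (lam ^ 3)).sub (hasDerivAt_const_mul_rpow (lam ^ 3) a ht)).sub
    (hasDerivAt_const_mul_rpow (lam ^ 2 * a) (a - 1) ht)).sub
    (hasDerivAt_const_mul_rpow (lam * a * (a - 1)) (a - 2) ht)).sub
    (hasDerivAt_const_mul_rpow (a * (a - 1) * (a - 2)) (a - 3) ht)).div_const 2
  refine h.congr_deriv ?_
  rw [show a - 1 - 1 = a - 2 by ring, show a - 2 - 1 = a - 3 by ring,
    show a - 3 - 1 = a - 4 by ring]
  simp only [fouForcing]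
  ring

theorem tendsto_exp_neg_mul_rpow {lam : ℝ} (hlam : 0 < lam) (c s : ℝ) :
    Tendsto (fun t : ℝ => c * (t ^ s * Real.exp (-lam * t))) atTop (𝓝 0) := by
  simpa using (tendsto_rpow_mul_exp_neg_mul_atTop_nhds_zero s lam hlam).const_mul c

theorem rpow_sub_five_le {a t : ℝ} (ht : 1 ≤ t) : t ^ (a - 5) ≤ t ^ (a - 4) :=
  Real.rpow_le_rpow_of_exponent_le ht (by linarith)

/-- With the integrating factor `exp (-lam * t)`, the perturbed forcing `q + ε * t ^ (a - 4)`
becomes increasing on `[1, ∞)` with limit `0`, hence is nonpositive there. -/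
theorem exists_fouForcing_le {lam a : ℝ} (hlam : 0 < lam) (ha0 : 0 < a) (ha1 : a < 1) :
    ∃ ε > 0, ∀ t, 1 ≤ t → fouForcing lam a t ≤ -ε * t ^ (a - 4) := by
  set C := a * (1 - a) * (2 - a) * (3 - a) / 2 with hC
  have hCpos : 0 < C := by
    have h1 : 0 < 1 - a := by linarith
    have h2 : 0 < 2 - a := by linarith
    have h3 : 0 < 3 - a := by linarith
    positivity
  -- The perturbation costs at most `ε * (lam + 4) * t ^ (a - 4)` in the derivative when `t ≥ 1`,
  -- because `4 - a ≤ 4` and `t ^ (a - 5) ≤ t ^ (a - 4)`.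
  set ε := C / (4 + lam) with hε
  have hεpos : 0 < ε := by positivity
  have hεC : ε * (4 + lam) = C := by rw [hε]; field_simp
  refine ⟨ε, hεpos, ?_⟩
  have hd : ∀ t, 1 ≤ t → HasDerivAt
      (fun t => Real.exp (-lam * t) * (fouForcing lam a t + ε * t ^ (a - 4)))
      (Real.exp (-lam * t) * (C * t ^ (a - 4) - ε * lam * t ^ (a - 4)
        - ε * (4 - a) * t ^ (a - 5))) t := by
    intro t ht
    have ht0 : 0 < t := by linarith
    have h1 : HasDerivAt (fun u => Real.exp (-lam * u)) (Real.exp (-lam * t) * -lam) t := by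
      simpa using ((hasDerivAt_id t).const_mul (-lam)).exp
    have h2 := hasDerivAt_const_mul_rpow ε (a - 4) ht0
    rw [show a - 4 - 1 = a - 5 by ring] at h2
    refine (h1.mul ((hasDerivAt_fouForcing hlam ha0 ha1 ht0).add h2)).congr_deriv ?_
    simp only [Pi.add_apply]
    ring
  have hmono : MonotoneOn
      (fun t => Real.exp (-lam * t) * (fouForcing lam a t + ε * t ^ (a - 4))) (Ici 1) := by
    refine monotoneOn_of_deriv_nonneg (convex_Ici 1)
      (fun t ht => (hd t ht).continuousAt.continuousWithinAt) ?_ ?_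
    · intro t ht
      rw [interior_Ici] at ht
      exact (hd t (le_of_lt ht)).differentiableAt.differentiableWithinAt
    · intro t ht
      rw [interior_Ici] at ht
      have ht1 : 1 ≤ t := le_of_lt ht
      rw [(hd t ht1).deriv]
      refine mul_nonneg (Real.exp_pos _).le ?_
      have hp : 0 ≤ t ^ (a - 5) := Real.rpow_nonneg (by linarith) _
      have h5 := rpow_sub_five_le (a := a) ht1
      have h6 : ε * (4 - a) * t ^ (a - 5) ≤ ε * 4 * t ^ (a - 4) := by
        refine mul_le_mul (mul_le_mul_of_nonneg_left (by linarith) hεpos.le) h5 hp (by positivity)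
      rw [← hεC]
      linarith
  have hlim : Tendsto
      (fun t => Real.exp (-lam * t) * (fouForcing lam a t + ε * t ^ (a - 4))) atTop (𝓝 0) := by
    have hr := tendsto_exp_neg_mul_rpow hlam
    have h := (((((tendsto_exp_neg_mul_expMean hlam ha0.le ha1.le).const_mul (lam ^ 3 / 2)).add
      (hr (-lam ^ 3 / 2) a)).add (hr (-lam ^ 2 * a / 2) (a - 1))).add
      (hr (-lam * a * (a - 1) / 2) (a - 2))).add (hr (-a * (a - 1) * (a - 2) / 2) (a - 3))
    have h' := h.add (hr ε (a - 4))
    simp only [mul_zero, add_zero] at h'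
    refine h'.congr fun t => ?_
    simp only [fouForcing]
    ring
  intro t ht
  have h := ge_of_tendsto hlim ((eventually_ge_atTop t).mono fun s hs =>
    hmono ht (mem_Ici.2 (ht.trans hs)) hs)
  have := nonpos_of_mul_nonpos_right h (Real.exp_pos _)
  linarith

/-- Now the integrating factor is `exp (lam * t)`: the upper bound on `q` makes `exp (lam * t) * (y
+ δ * t ^ (a - 4))` decreasing on `[1, ∞)`. So `y` is at most `-δ * t ^ (a - 4)` plus a multiple of
`exp (-lam * t)`, and the power wins. -/
theorem eventually_fouCovDeriv2_neg {lam a : ℝ} (hlam : 0 < lam) (ha0 : 0 < a) (ha1 : a < 1) :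
    ∀ᶠ t in atTop, fouCovDeriv2 lam a t < 0 := by
  obtain ⟨ε, hε, hq⟩ := exists_fouForcing_le hlam ha0 ha1
  set δ := ε / lam with hδ
  have hδpos : 0 < δ := by positivity
  have hδε : δ * lam = ε := by rw [hδ]; field_simp
  have hd : ∀ t, 1 ≤ t → HasDerivAt
      (fun t => Real.exp (lam * t) * (fouCovDeriv2 lam a t + δ * t ^ (a - 4)))
      (Real.exp (lam * t) * (fouForcing lam a t + ε * t ^ (a - 4)
        - δ * (4 - a) * t ^ (a - 5))) t := by
    intro t ht
    have ht0 : 0 < t := by linarith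
    have h1 : HasDerivAt (fun u => Real.exp (lam * u)) (Real.exp (lam * t) * lam) t := by
      simpa using ((hasDerivAt_id t).const_mul lam).exp
    have h2 := hasDerivAt_const_mul_rpow δ (a - 4) ht0
    rw [show a - 4 - 1 = a - 5 by ring] at h2
    have h3 := hasDerivAt_fouCovDeriv2 hlam ha0 ha1 ht0
    rw [fouForcing_eq ht0] at h3
    refine (h1.mul (h3.add h2)).congr_deriv ?_
    simp only [Pi.add_apply]
    rw [← hδε]
    ring
  have hanti : AntitoneOn
      (fun t => Real.exp (lam * t) * (fouCovDeriv2 lam a t + δ * t ^ (a - 4))) (Ici 1) := by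
    refine antitoneOn_of_deriv_nonpos (convex_Ici 1)
      (fun t ht => (hd t ht).continuousAt.continuousWithinAt) ?_ ?_
    · intro t ht
      rw [interior_Ici] at ht
      exact (hd t (le_of_lt ht)).differentiableAt.differentiableWithinAt
    · intro t ht
      rw [interior_Ici] at ht
      have ht1 : 1 ≤ t := le_of_lt ht
      rw [(hd t ht1).deriv]
      refine mul_nonpos_of_nonneg_of_nonpos (Real.exp_pos _).le ?_
      have hp : 0 ≤ δ * (4 - a) * t ^ (a - 5) :=
        mul_nonneg (mul_nonneg hδpos.le (by linarith)) (Real.rpow_nonneg (by linarith) _)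
      linarith [hq t ht1]
  set M := Real.exp (lam * 1) * (fouCovDeriv2 lam a 1 + δ * 1 ^ (a - 4))
  filter_upwards [(tendsto_exp_neg_mul_rpow hlam M (4 - a)).eventually (gt_mem_nhds hδpos),
    eventually_ge_atTop 1] with t ht ht1
  have h := hanti (mem_Ici.2 le_rfl) (mem_Ici.2 ht1) ht1
  change Real.exp (lam * t) * (fouCovDeriv2 lam a t + δ * t ^ (a - 4)) ≤ M at h
  have ht0 : 0 < t := by linarith
  have e1 : t ^ (4 - a) * t ^ (a - 4) = 1 := by
    rw [← Real.rpow_add ht0]; simp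
  have e2 : Real.exp (-lam * t) * Real.exp (lam * t) = 1 := by
    rw [← Real.exp_add]; simp
  have hp : 0 < t ^ (4 - a) := Real.rpow_pos_of_pos ht0 _
  have h2 := mul_le_mul_of_nonneg_left h (mul_pos hp (Real.exp_pos (-lam * t))).le
  have h3 : t ^ (4 - a) * Real.exp (-lam * t) * (Real.exp (lam * t) *
      (fouCovDeriv2 lam a t + δ * t ^ (a - 4))) = t ^ (4 - a) * fouCovDeriv2 lam a t + δ := by
    linear_combination (t ^ (4 - a) * (fouCovDeriv2 lam a t + δ * t ^ (a - 4))) * e2 + δ * e1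
  have h4 : t ^ (4 - a) * fouCovDeriv2 lam a t < 0 := by linarith
  exact neg_of_mul_neg_right h4 hp.le

theorem exists_fouCovDeriv2_thresholds {lam a : ℝ} (hlam : 0 < lam) (ha0 : 0 < a) (ha1 : a < 1) :
    ∃ T₀ T₁, 0 < T₀ ∧ T₀ < T₁ ∧ fouCovDeriv2 lam a T₀ = 0 ∧
      (∀ t ∈ Ioo 0 T₀, 0 < fouCovDeriv2 lam a t) ∧ ∀ t ∈ Ioi T₁, fouCovDeriv2 lam a t < 0 := by
  obtain ⟨δ, hδ, hpos⟩ := mem_nhdsGT_iff_exists_Ioo_subset.1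
    (eventually_fouCovDeriv2_pos hlam ha0 ha1)
  obtain ⟨T, hT⟩ := eventually_atTop.1 (eventually_fouCovDeriv2_neg hlam ha0 ha1)
  have hδ0 : (0 : ℝ) < δ := hδ
  have hδT : δ ≤ max T δ := le_max_right _ _
  -- `T₀` is the first point where positivity fails. Cutting off at `δ / 2`, inside the interval of
  -- positivity, keeps `S` closed and away from the singularity at `0`.
  set S := {t | t ∈ Icc (δ / 2) (max T δ) ∧ fouCovDeriv2 lam a t ≤ 0} with hS
  have hcont := continuousOn_fouCovDeriv2 hlam ha0 ha1
  have hScl : IsClosed S :=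
    (hcont.mono fun t ht => lt_of_lt_of_le (half_pos hδ0) ht.1).preimage_isClosed_of_isClosed
      isClosed_Icc isClosed_Iic
  have hne : S.Nonempty :=
    ⟨max T δ, ⟨by linarith, le_rfl⟩, (hT _ (le_max_left _ _)).le⟩
  have hbdd : BddBelow S := ⟨δ / 2, fun t ht => ht.1.1⟩
  have hmem := hScl.csInf_mem hne hbdd
  set T₀ := sInf S
  have hT₀ : 0 < T₀ := lt_of_lt_of_le (half_pos hδ0) hmem.1.1
  have hlt : ∀ t ∈ Ioo 0 T₀, 0 < fouCovDeriv2 lam a t := by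
    intro t ht
    rcases lt_or_ge t δ with h | h
    · exact hpos ⟨ht.1, h⟩
    · by_contra hcon
      exact absurd (csInf_le hbdd ⟨⟨by linarith, ht.2.le.trans hmem.1.2⟩, not_lt.1 hcon⟩)
        (not_le.2 ht.2)
  -- Minimality gives `≥ 0` at `T₀` by a limit from the left; membership in `S` gives `≤ 0`.
  refine ⟨T₀, max T T₀ + 1, hT₀, by linarith [le_max_right T T₀], le_antisymm hmem.2 ?_, hlt, ?_⟩
  · have hc : Tendsto (fouCovDeriv2 lam a) (𝓝[<] T₀) (𝓝 (fouCovDeriv2 lam a T₀)) :=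
      ((hcont.continuousAt (Ioi_mem_nhds hT₀)).tendsto).mono_left nhdsWithin_le_nhds
    exact ge_of_tendsto hc (by
      filter_upwards [Ioo_mem_nhdsLT hT₀] with t ht using (hlt t ht).le)
  · intro t ht
    exact hT t (by linarith [le_max_left T T₀, mem_Ioi.1 ht])

/-! ### Riemann-Stieltjes sums with values in a Banach space -/

/-- Left-tagged Riemann-Stieltjes sums `∑ f (τ i) • (g (τ (i + 1)) - g (τ i))` over uniform
partitions converge, for `f` continuously differentiable and `g` continuous with values in a Banach
space. -/
theorem tendsto_sum_smul_sub {E : Type*} [NormedAddCommGroup E] [NormedSpace ℝ E]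
    {f f' : ℝ → ℝ} {g : ℝ → E} (hf : ∀ x, HasDerivAt f (f' x) x) (hf' : Continuous f')
    (hg : Continuous g) [CompleteSpace E] {c d : ℝ} (hcd : c ≤ d) :
    Tendsto (fun n : ℕ => ∑ i ∈ Finset.range n, f (c + (d - c) * i / n) •
      (g (c + (d - c) * (i + 1 : ℕ) / n) - g (c + (d - c) * i / n))) atTop
      (𝓝 (f d • g d - f c • g c - ∫ s in c..d, f' s • g s)) := by
  obtain ⟨C, hC⟩ := isCompact_Icc.exists_bound_of_continuousOn (s := Icc c d) hf'.continuousOn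
  have hC0 : 0 ≤ C := (norm_nonneg _).trans (hC c ⟨le_rfl, hcd⟩)
  rw [Metric.tendsto_atTop]
  intro ε hε
  set η := ε / (2 * (C * (d - c) + 1)) with hη
  have hB : 0 ≤ C * (d - c) := mul_nonneg hC0 (by linarith)
  have hηpos : 0 < η := by positivity
  obtain ⟨δ, hδ, hun⟩ := Metric.uniformContinuousOn_iff.1
    (isCompact_Icc.uniformContinuousOn_of_continuous (s := Icc c d) hg.continuousOn) η hηpos
  obtain ⟨N, hN⟩ := exists_nat_gt ((d - c) / δ)
  refine ⟨N + 1, fun n hn => ?_⟩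
  have hn0 : (0 : ℝ) < n := by exact_mod_cast (by omega : 0 < n)
  have hnN : (N : ℝ) ≤ n := by exact_mod_cast (by omega : N ≤ n)
  have hmesh : (d - c) / n < δ := by
    rw [div_lt_iff₀ hn0]
    rw [div_lt_iff₀ hδ] at hN
    nlinarith
  set τ : ℕ → ℝ := fun i => c + (d - c) * i / n with hτ
  have hτ0 : τ 0 = c := by simp [hτ]
  have hτn : τ n = d := by simp only [hτ]; field_simp; ring
  have hstep : ∀ i, τ (i + 1) - τ i = (d - c) / n := by
    intro i; simp only [hτ]; push_cast; ring
  have hstep0 : 0 ≤ (d - c) / n := div_nonneg (by linarith) hn0.le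
  have hτmono : Monotone τ := monotone_nat_of_le_succ fun i => by linarith [hstep i]
  have hfg : Continuous fun s => f' s • g s := hf'.smul hg
  have hpart : f d • g d - f c • g c = ∑ i ∈ Finset.range n,
      (f (τ (i + 1)) • g (τ (i + 1)) - f (τ i) • g (τ i)) := by
    rw [Finset.sum_range_sub (fun i => f (τ i) • g (τ i)), hτn, hτ0]
  have hint : ∫ s in c..d, f' s • g s
      = ∑ i ∈ Finset.range n, ∫ s in τ i..τ (i + 1), f' s • g s := by
    rw [intervalIntegral.sum_integral_adjacent_intervals
      (fun k _ => hfg.intervalIntegrable _ _), hτn, hτ0]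
  -- Integration by parts on one cell: the error sees `g` only through its oscillation over the
  -- cell, so continuity of `g` suffices and bounded variation is not needed.
  have hterm : ∀ i, f (τ i) • (g (τ (i + 1)) - g (τ i))
      - ((f (τ (i + 1)) • g (τ (i + 1)) - f (τ i) • g (τ i)) - ∫ s in τ i..τ (i + 1), f' s • g s)
      = ∫ s in τ i..τ (i + 1), f' s • (g s - g (τ (i + 1))) := by
    intro i
    have h1 : ∫ s in τ i..τ (i + 1), f' s = f (τ (i + 1)) - f (τ i) :=
      intervalIntegral.integral_eq_sub_of_hasDerivAt (fun x _ => hf x)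
        (hf'.intervalIntegrable _ _)
    have hc : Continuous fun s => f' s • g (τ (i + 1)) := hf'.smul continuous_const
    simp only [smul_sub]
    rw [intervalIntegral.integral_sub (hfg.intervalIntegrable _ _)
      (hc.intervalIntegrable _ _), intervalIntegral.integral_smul_const,
      h1, sub_smul]
    abel
  have hle : ∀ i ∈ Finset.range n,
      ‖∫ s in τ i..τ (i + 1), f' s • (g s - g (τ (i + 1)))‖ ≤ C * η * ((d - c) / n) := by
    intro i hi
    have hin := Finset.mem_range.1 hi
    have h := intervalIntegral.norm_integral_le_of_norm_le_const (a := τ i) (b := τ (i + 1))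
      (f := fun s => f' s • (g s - g (τ (i + 1)))) (C := C * η) ?_
    · rwa [hstep, abs_of_nonneg hstep0] at h
    · intro s hs
      rw [uIoc_of_le (hτmono (Nat.le_succ i))] at hs
      have hc : c ≤ τ i := hτ0 ▸ hτmono (Nat.zero_le i)
      have hd : τ (i + 1) ≤ d := hτn ▸ hτmono (by omega : i + 1 ≤ n)
      have hsm : s ∈ Icc c d := ⟨by linarith [hs.1], hs.2.trans hd⟩
      rw [norm_smul]
      refine mul_le_mul (hC s hsm) ?_ (norm_nonneg _) hC0
      rw [← dist_eq_norm]
      refine (hun s hsm _ ⟨by linarith [hs.1, hs.2], hd⟩ ?_).le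
      rw [Real.dist_eq, abs_sub_comm, abs_of_nonneg (by linarith [hs.2])]
      linarith [hs.1, hstep i]
  rw [dist_eq_norm, hpart, hint, ← Finset.sum_sub_distrib, ← Finset.sum_sub_distrib,
    Finset.sum_congr rfl fun i _ => hterm i]
  calc _ ≤ ∑ i ∈ Finset.range n, C * η * ((d - c) / n) :=
        (norm_sum_le _ _).trans (Finset.sum_le_sum hle)
    _ = C * (d - c) * η := by
        rw [Finset.sum_const, Finset.card_range, nsmul_eq_mul]; field_simp
    _ < ε := by
        rw [hη, mul_div_assoc', div_lt_iff₀ (by positivity)]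
        nlinarith

/-! ### The Ornstein-Uhlenbeck vector of a fractional curve -/

theorem integral_mul_const_add_sub_div_two {α : Type*} [MeasurableSpace α] {μ : Measure α}
    {w f g : α → ℝ} (hw : Integrable w μ) (hf : Integrable f μ) (hg : Integrable g μ) (c : ℝ) :
    ∫ u, (w u * c + (f u - g u) / 2) ∂μ = (∫ u, w u ∂μ) * c + (∫ u, f u ∂μ - ∫ u, g u ∂μ) / 2 := by
  have h : Integrable (fun u => (f u - g u) / 2) μ := (hf.sub hg).div_const 2
  rw [integral_add (hw.mul_const c) h, integral_mul_const, integral_div, integral_sub hf hg]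

/-- A curve in a Hilbert space with the covariance of fractional Brownian motion of Hurst
parameter `a / 2`. -/
def IsFractionalCurve {E : Type*} [NormedAddCommGroup E] [InnerProductSpace ℝ E] (a : ℝ)
    (b : ℝ → E) : Prop :=
  ∀ s t, inner ℝ (b s) (b t) = (|s| ^ a + |t| ^ a - |t - s| ^ a) / 2

/-- The stationary Ornstein-Uhlenbeck vector `∫_{-∞}^t exp (-lam * (t - s)) d(b s)`, after an
integration by parts. -/
noncomputable def ouVec {E : Type*} [NormedAddCommGroup E] [NormedSpace ℝ E] (lam : ℝ)
    (b : ℝ → E) (t : ℝ) : E :=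
  ∫ u in Ioi (0 : ℝ), (lam * Real.exp (-lam * u)) • (b t - b (t - u))

namespace IsFractionalCurve

variable {E : Type*} [NormedAddCommGroup E] [InnerProductSpace ℝ E] {a : ℝ} {b : ℝ → E}

theorem norm_sub_sq (h : IsFractionalCurve a b) (ha0 : 0 < a) (s t : ℝ) :
    ‖b t - b s‖ ^ 2 = |t - s| ^ a := by
  rw [@norm_sub_sq_real, ← real_inner_self_eq_norm_sq, ← real_inner_self_eq_norm_sq, h, h, h,
    sub_self, sub_self, abs_zero, Real.zero_rpow ha0.ne', abs_sub_comm s t]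
  ring

theorem norm_sub_le (h : IsFractionalCurve a b) (ha0 : 0 < a) (ha1 : a < 1) (s t : ℝ) :
    ‖b t - b s‖ ≤ 1 + |t - s| := by
  have h1 := h.norm_sub_sq ha0 s t
  have h2 := abs_rpow_le_one_add_abs ha0.le ha1.le (t - s)
  nlinarith [norm_nonneg (b t - b s), abs_nonneg (t - s)]

theorem continuous (h : IsFractionalCurve a b) (ha0 : 0 < a) : Continuous b := by
  refine continuous_iff_continuousAt.2 fun s => ?_
  rw [ContinuousAt, tendsto_iff_norm_sub_tendsto_zero]
  have h1 : Tendsto (fun t => √(|t - s| ^ a)) (𝓝 s) (𝓝 (√(|s - s| ^ a))) :=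
    (Real.continuous_sqrt.comp ((continuous_abs_rpow ha0.le).comp
      (continuous_id.sub continuous_const))).tendsto s
  rw [sub_self, abs_zero, Real.zero_rpow ha0.ne', Real.sqrt_zero] at h1
  refine h1.congr fun t => ?_
  rw [← h.norm_sub_sq ha0, Real.sqrt_sq (norm_nonneg _)]

theorem inner_sub_sub (h : IsFractionalCurve a b) (s t u v : ℝ) :
    inner ℝ (b t - b (t - v)) (b s - b (s - u))
      = (|-(t - s) + v| ^ a + |t - s + u| ^ a - |t - s| ^ a - |t - s - v + u| ^ a) / 2 := by
  simp only [inner_sub_left, inner_sub_right, h _ _]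
  rw [abs_sub_comm s t, show s - u - t = -(t - s + u) by ring, abs_neg,
    show s - (t - v) = -(t - s) + v by ring, show s - u - (t - v) = -(t - s - v + u) by ring,
    abs_neg]
  ring

variable {lam : ℝ}

theorem integrableOn (h : IsFractionalCurve a b) (hlam : 0 < lam) (ha0 : 0 < a) (ha1 : a < 1)
    (t : ℝ) :
    IntegrableOn (fun u => (lam * Real.exp (-lam * u)) • (b t - b (t - u))) (Ioi 0) := by
  refine integrableOn_exp_smul_of_le (A := 1) (C := 1) hlam
    (continuous_const.sub ((h.continuous ha0).comp (by fun_prop))) fun u hu => ?_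
  have := h.norm_sub_le ha0 ha1 (t - u) t
  rwa [sub_sub_cancel, abs_of_pos hu, ← one_mul (1 + u), mul_add, one_mul] at this

theorem inner_ouVec [CompleteSpace E] (h : IsFractionalCurve a b) (hlam : 0 < lam) (ha0 : 0 < a)
    (ha1 : a < 1) (x : E) (t : ℝ) : inner ℝ x (ouVec lam b t)
      = ∫ u in Ioi (0 : ℝ), lam * Real.exp (-lam * u) * inner ℝ x (b t - b (t - u)) := by
  rw [ouVec, ← integral_inner (h.integrableOn hlam ha0 ha1 t)]
  simp only [inner_smul_right]

/-- The inner product passes through one Bochner integral at a time. The first average produces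
`expMean`; the second averages `expMean` itself, which `integral_exp_mul_expMean_neg` evaluates. -/
theorem inner_ouVec_ouVec [CompleteSpace E] (h : IsFractionalCurve a b) (hlam : 0 < lam)
    (ha0 : 0 < a) (ha1 : a < 1) (s t : ℝ) :
    inner ℝ (ouVec lam b s) (ouVec lam b t) = fouCov lam a (t - s) := by
  have hexp : IntegrableOn (fun u : ℝ => lam * Real.exp (-lam * u)) (Ioi 0) :=
    (integrableOn_exp_mul_Ioi (by linarith) 0).const_mul lam
  have hI := integrableOn_exp_mul_abs_rpow hlam ha0.le ha1.le
  have h1 : ∀ v, inner ℝ (b t - b (t - v)) (ouVec lam b s)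
      = (|-(t - s) + v| ^ a + expMean lam a (t - s) - |t - s| ^ a
        - expMean lam a (-(-(t - s) + v))) / 2 := by
    intro v
    rw [h.inner_ouVec hlam ha0 ha1]
    simp only [h.inner_sub_sub]
    have e : ∀ u : ℝ, lam * Real.exp (-lam * u) *
        ((|-(t - s) + v| ^ a + |t - s + u| ^ a - |t - s| ^ a - |t - s - v + u| ^ a) / 2)
        = lam * Real.exp (-lam * u) * ((|-(t - s) + v| ^ a - |t - s| ^ a) / 2)
          + (lam * Real.exp (-lam * u) * |t - s + u| ^ a
            - lam * Real.exp (-lam * u) * |t - s - v + u| ^ a) / 2 := fun u => by ring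
    simp only [e]
    rw [integral_mul_const_add_sub_div_two hexp (hI _) (hI _), integral_exp_density hlam,
      show -(-(t - s) + v) = t - s - v by ring]
    simp only [expMean]
    ring
  rw [h.inner_ouVec hlam ha0 ha1]
  have e : ∀ v : ℝ, lam * Real.exp (-lam * v) * inner ℝ (ouVec lam b s) (b t - b (t - v))
      = lam * Real.exp (-lam * v) * ((expMean lam a (t - s) - |t - s| ^ a) / 2)
        + (lam * Real.exp (-lam * v) * |-(t - s) + v| ^ a
          - lam * Real.exp (-lam * v) * expMean lam a (-(-(t - s) + v))) / 2 := fun v => by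
    rw [real_inner_comm, h1]; ring
  simp only [e]
  obtain ⟨hL, hL'⟩ := integral_exp_mul_expMean_neg hlam ha0.le ha1.le (-(t - s))
  rw [integral_mul_const_add_sub_div_two hexp (hI _) hL, integral_exp_density hlam, hL', neg_neg,
    show ∫ v in Ioi (0 : ℝ), lam * Real.exp (-lam * v) * |-(t - s) + v| ^ a
    = expMean lam a (-(t - s)) from rfl, fouCov]
  ring

/-- The limit of the Riemann-Stieltjes sums over `[t - A, t]` tends to `ouVec` as `A → ∞`. -/
theorem tendsto_ouVec [CompleteSpace E] (h : IsFractionalCurve a b) (hlam : 0 < lam) (ha0 : 0 < a)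
    (ha1 : a < 1) (t : ℝ) :
    Tendsto (fun A => Real.exp (-lam * (t - t)) • b t - Real.exp (-lam * (t - (t - A))) • b (t - A)
      - ∫ s in (t - A)..t, (lam * Real.exp (-lam * (t - s))) • b s) atTop
      (𝓝 (ouVec lam b t)) := by
  have hb := h.continuous ha0
  have h1 := intervalIntegral_tendsto_integral_Ioi 0 (h.integrableOn hlam ha0 ha1 t) tendsto_id
  -- This is exactly the difference between the boundary form of the integral over `[t - A, t]` and
  -- the truncation of `ouVec` to `[0, A]`.
  have h2 : Tendsto (fun A => Real.exp (-lam * A) • (b t - b (t - A))) atTop (𝓝 0) := by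
    have e := (tendsto_exp_neg_mul_rpow hlam 1 0).add (tendsto_exp_neg_mul_rpow hlam 1 1)
    rw [add_zero] at e
    refine squeeze_zero_norm' ?_ e
    filter_upwards [eventually_gt_atTop 0] with A hA
    have := h.norm_sub_le ha0 ha1 (t - A) t
    rw [sub_sub_cancel, abs_of_pos hA] at this
    rw [norm_smul, Real.norm_eq_abs, abs_of_pos (Real.exp_pos _), Real.rpow_zero, Real.rpow_one]
    have := mul_le_mul_of_nonneg_left this (Real.exp_pos (-lam * A)).le
    linarith
  have h3 := h1.add h2
  rw [add_zero] at h3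
  refine h3.congr fun A => ?_
  have hc1 : Continuous fun u => (lam * Real.exp (-lam * u)) • b t := by fun_prop
  have hc2 : Continuous fun u => (lam * Real.exp (-lam * u)) • b (t - u) := by fun_prop
  have hexp : ∫ u in (0 : ℝ)..A, lam * Real.exp (-lam * u) = 1 - Real.exp (-lam * A) := by
    have hd : ∀ u ∈ uIcc 0 A, HasDerivAt (fun u => -Real.exp (-lam * u))
        (lam * Real.exp (-lam * u)) u := fun u _ => by
      have := (((hasDerivAt_id u).const_mul (-lam)).exp).neg
      refine this.congr_deriv ?_
      simp; ring
    rw [intervalIntegral.integral_eq_sub_of_hasDerivAt hd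
      ((by fun_prop : Continuous fun u => lam * Real.exp (-lam * u)).intervalIntegrable _ _)]
    simp; ring
  have hsub := intervalIntegral.integral_comp_sub_left (a := 0) (b := A)
    (fun s => (lam * Real.exp (-lam * (t - s))) • b s) t
  simp only [sub_sub_cancel, sub_zero] at hsub
  rw [← hsub]
  simp only [id, smul_sub]
  rw [intervalIntegral.integral_sub (hc1.intervalIntegrable _ _) (hc2.intervalIntegrable _ _),
    intervalIntegral.integral_smul_const, hexp]
  simp only [sub_self, mul_zero, Real.exp_zero, one_smul, sub_smul, sub_sub_cancel]
  abel

end IsFractionalCurve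

/-! ### From pathwise integrals to `L²` -/

theorem HasYoungIntegral.tendsto_uniform {f g : ℝ → ℝ} {a b I : ℝ} (h : HasYoungIntegral f g a b I)
    (hab : a ≤ b) :
    Tendsto (fun n : ℕ => ∑ i ∈ Finset.range n, f (a + (b - a) * i / n) *
      (g (a + (b - a) * (i + 1 : ℕ) / n) - g (a + (b - a) * i / n))) atTop (𝓝 I) := by
  rw [Metric.tendsto_atTop]
  intro ε hε
  obtain ⟨δ, hδ, hI⟩ := h ε hε
  obtain ⟨N, hN⟩ := exists_nat_gt ((b - a) / δ)
  refine ⟨N + 1, fun n hn => ?_⟩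
  have hn0 : (0 : ℝ) < n := by exact_mod_cast (by omega : 0 < n)
  have hnN : (N : ℝ) ≤ n := by exact_mod_cast (by omega : N ≤ n)
  have hmesh : (b - a) / n < δ := by
    rw [div_lt_iff₀ hn0]
    rw [div_lt_iff₀ hδ] at hN
    nlinarith
  have hstep0 : 0 ≤ (b - a) / n := div_nonneg (by linarith) hn0.le
  refine hI n (fun i => a + (b - a) * i / n) (fun i => a + (b - a) * i / n) (by simp)
    (by field_simp; ring) fun i _ => ?_
  have hstep : a + (b - a) * (i + 1 : ℕ) / n - (a + (b - a) * i / n) = (b - a) / n := by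
    push_cast; ring
  exact ⟨le_rfl, by linarith, by linarith⟩

/-- The null set is fixed before `c`, so `c` may depend on `ω` with no measurability required. This
lets pathwise limits be compared with `L²` limits. -/
theorem MeasureTheory.Lp.ae_eq_of_tendsto {Ω : Type*} [MeasurableSpace Ω] {P : Measure Ω}
    {F : ℕ → Lp ℝ 2 P} {G : Lp ℝ 2 P} (h : Tendsto F atTop (𝓝 G)) :
    ∀ᵐ ω ∂P, ∀ c, Tendsto (fun n => F n ω) atTop (𝓝 c) → G ω = c := by
  obtain ⟨ns, hns, hlim⟩ := (tendstoInMeasure_of_tendsto_Lp h).exists_seq_tendsto_ae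
  filter_upwards [hlim] with ω hω c hc
  exact tendsto_nhds_unique hω (hc.comp hns.tendsto_atTop)

namespace IsFractionalBrownianMotion

variable {Ω : Type u} [MeasurableSpace Ω] {P : Measure Ω} {H : ℝ} {B : ℝ → Ω → ℝ}

theorem memLp (h : IsFractionalBrownianMotion H B P) (t : ℝ) : MemLp (B t) 2 P :=
  (h.1.hasGaussianLaw_eval t).memLp_two

/-- The fractional Brownian motion as a curve in `L²`. -/
noncomputable def curve (h : IsFractionalBrownianMotion H B P) (t : ℝ) : Lp ℝ 2 P :=
  (h.memLp t).toLp (B t)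

theorem coeFn_curve (h : IsFractionalBrownianMotion H B P) (t : ℝ) : h.curve t =ᵐ[P] B t :=
  (h.memLp t).coeFn_toLp

theorem isFractionalCurve (h : IsFractionalBrownianMotion H B P) :
    IsFractionalCurve (2 * H) h.curve := by
  intro s t
  rw [L2.inner_def, ← h.covariance_eq]
  refine integral_congr_ae ?_
  filter_upwards [h.coeFn_curve s, h.coeFn_curve t] with ω hs ht
  rw [hs, ht]
  simp [mul_comm]

theorem coeFn_sum_smul_sub (h : IsFractionalBrownianMotion H B P) (s : Finset ℕ) (c x y : ℕ → ℝ) :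
    (∑ i ∈ s, c i • (h.curve (x i) - h.curve (y i)) : Lp ℝ 2 P)
      =ᵐ[P] fun ω => ∑ i ∈ s, c i * (B (x i) ω - B (y i) ω) := by
  induction s using Finset.induction_on with
  | empty =>
    simp only [Finset.sum_empty]
    exact Lp.coeFn_zero ℝ 2 P
  | insert j s hj ih =>
    simp only [Finset.sum_insert hj]
    filter_upwards [ih, Lp.coeFn_add (c j • (h.curve (x j) - h.curve (y j)))
      (∑ i ∈ s, c i • (h.curve (x i) - h.curve (y i))),
      Lp.coeFn_smul (c j) (h.curve (x j) - h.curve (y j)),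
      Lp.coeFn_sub (h.curve (x j)) (h.curve (y j)), h.coeFn_curve (x j), h.coeFn_curve (y j)]
      with ω h1 h2 h3 h4 h5 h6
    rw [h2, Pi.add_apply, h1, h3, Pi.smul_apply, h4, Pi.sub_apply, h5, h6, smul_eq_mul]

end IsFractionalBrownianMotion

namespace IsStationaryFOU

variable {Ω : Type u} [MeasurableSpace Ω] {P : Measure Ω} {H lam σ : ℝ} {B X : ℝ → Ω → ℝ}

/-- The same Riemann sums converge pathwise to the Young integral and in `L²` to the
integrated-by-parts vector; both limits then pass to the lower endpoint `-∞`. -/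
theorem ae_eq_ouVec (h : IsStationaryFOU H lam σ B X P) (hH0 : 0 < H) (hH : H < 1 / 2)
    (hlam : 0 < lam) (t : ℝ) :
    X t =ᵐ[P] fun ω => σ * (ouVec lam h.isFBM.curve t : Lp ℝ 2 P) ω := by
  have hb := h.isFBM.isFractionalCurve
  have ha0 : 0 < 2 * H := by linarith
  have ha1 : 2 * H < 1 := by linarith
  have hf : ∀ s, HasDerivAt (fun s => Real.exp (-lam * (t - s)))
      (lam * Real.exp (-lam * (t - s))) s := fun s => by
    have := (((hasDerivAt_id s).const_sub t).const_mul (-lam)).exp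
    refine this.congr_deriv ?_
    simp; ring
  have hA := (hb.tendsto_ouVec hlam ha0 ha1 t).comp tendsto_natCast_atTop_atTop
  have hS := fun N : ℕ => tendsto_sum_smul_sub hf (by fun_prop) (hb.continuous ha0)
    (sub_le_self t N.cast_nonneg)
  -- Integer lower endpoints `t - N` and uniform partitions leave only countably many null sets to
  -- discard.
  filter_upwards [h.eq_integral t, Lp.ae_eq_of_tendsto hA,
    ae_all_iff.2 fun N => Lp.ae_eq_of_tendsto (hS N),
    ae_all_iff.2 fun N : ℕ => ae_all_iff.2 fun n : ℕ => h.isFBM.coeFn_sum_smul_sub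
      (Finset.range n) (fun i => Real.exp (-lam * (t - (t - N + (t - (t - N)) * i / n))))
      (fun i => t - N + (t - (t - N)) * (i + 1 : ℕ) / n)
      (fun i => t - N + (t - (t - N)) * i / n)] with ω hω h1 h2 h3
  obtain ⟨I, ⟨J, hJ, hJI⟩, hX⟩ := hω
  rw [hX, h1 I]
  have hJN : Tendsto (fun N : ℕ => J (t - N)) atTop (𝓝 I) :=
    hJI.comp ((tendsto_atBot_add_const_left _ t
      (tendsto_neg_atTop_atBot.comp tendsto_natCast_atTop_atTop)).congr fun N => by
        simp [sub_eq_add_neg])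
  refine hJN.congr' ?_
  filter_upwards [eventually_ge_atTop 1] with N hN
  have hN0 : (0 : ℝ) < N := by exact_mod_cast hN
  refine (h2 N (J (t - N)) ?_).symm
  refine ((hJ (t - N) (by linarith)).tendsto_uniform (by linarith)).congr fun n => ?_
  exact (h3 N n).symm

theorem memLp (h : IsStationaryFOU H lam σ B X P) (hH0 : 0 < H) (hH : H < 1 / 2)
    (hlam : 0 < lam) (t : ℝ) : MemLp (X t) 2 P :=
  (memLp_congr_ae (h.ae_eq_ouVec hH0 hH hlam t)).2 ((Lp.memLp _).const_mul σ)

theorem integral_mul (h : IsStationaryFOU H lam σ B X P) (hH0 : 0 < H) (hH : H < 1 / 2)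
    (hlam : 0 < lam) (s t : ℝ) :
    ∫ ω, X s ω * X t ω ∂P = σ ^ 2 * fouCov lam (2 * H) (t - s) := by
  rw [← h.isFBM.isFractionalCurve.inner_ouVec_ouVec hlam (by linarith) (by linarith),
    L2.inner_def, ← integral_const_mul]
  refine integral_congr_ae ?_
  filter_upwards [h.ae_eq_ouVec hH0 hH hlam s, h.ae_eq_ouVec hH0 hH hlam t] with ω hs ht
  rw [hs, ht]
  simp
  ring

theorem integral_eq_zero [IsProbabilityMeasure P] (h : IsStationaryFOU H lam σ B X P)
    (hH0 : 0 < H) (hH : H < 1 / 2) (hlam : 0 < lam) (t : ℝ) : ∫ ω, X t ω ∂P = 0 := by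
  -- The mean is the inner product with the constant `1`, so it passes under the integral defining
  -- `ouVec`.
  have hinner : ∀ f : Lp ℝ 2 P,
      inner ℝ ((memLp_const 1 : MemLp (fun _ : Ω => (1 : ℝ)) 2 P).toLp _) f = ∫ ω, f ω ∂P := by
    intro f
    rw [L2.inner_def]
    refine integral_congr_ae ?_
    filter_upwards [(memLp_const 1 : MemLp (fun _ : Ω => (1 : ℝ)) 2 P).coeFn_toLp] with ω hω
    rw [hω]
    simp
  have hcurve : ∀ s, ∫ ω, h.isFBM.curve s ω ∂P = 0 := fun s => by
    rw [integral_congr_ae (h.isFBM.coeFn_curve s), h.isFBM.mean_eq_zero]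
  rw [integral_congr_ae (h.ae_eq_ouVec hH0 hH hlam t), integral_const_mul, ← hinner,
    h.isFBM.isFractionalCurve.inner_ouVec hlam (by linarith) (by linarith)]
  simp only [inner_sub_right]
  simp only [hinner, hcurve, sub_self, mul_zero, integral_zero]

theorem covFun_eq [IsProbabilityMeasure P] (h : IsStationaryFOU H lam σ B X P)
    (hH0 : 0 < H) (hH : H < 1 / 2) (hlam : 0 < lam) :
    covFun X P = fun t => σ ^ 2 * fouCov lam (2 * H) t := by
  funext t
  rw [covFun, covariance_eq_sub (h.memLp hH0 hH hlam 0) (h.memLp hH0 hH hlam t),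
    h.integral_eq_zero hH0 hH hlam, zero_mul, sub_zero]
  simpa using h.integral_mul hH0 hH hlam 0 t

theorem integral_increments [IsProbabilityMeasure P] (h : IsStationaryFOU H lam σ B X P)
    (hH0 : 0 < H) (hH : H < 1 / 2) (hlam : 0 < lam) (a b c d : ℝ) :
    Integrable (fun ω => (X b ω - X a ω) * (X d ω - X c ω)) P ∧
    ∫ ω, (X b ω - X a ω) * (X d ω - X c ω) ∂P
      = covFun X P (d - b) - covFun X P (c - b) - covFun X P (d - a) + covFun X P (c - a) := by
  have hm := h.memLp hH0 hH hlam
  have hi : ∀ s t, Integrable (fun ω => X s ω * X t ω) P := fun s t =>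
    (hm s).integrable_mul (hm t)
  refine ⟨((hm b).sub (hm a)).integrable_mul ((hm d).sub (hm c)), ?_⟩
  have e : ∀ ω, (X b ω - X a ω) * (X d ω - X c ω)
      = ((X b ω * X d ω - X b ω * X c ω) - X a ω * X d ω) + X a ω * X c ω := fun ω => by ring
  simp only [e]
  have h1 : Integrable (fun ω => X b ω * X d ω - X b ω * X c ω) P := (hi b d).sub (hi b c)
  have h2 : Integrable (fun ω => X b ω * X d ω - X b ω * X c ω - X a ω * X d ω) P :=
    h1.sub (hi a d)
  rw [integral_add h2 (hi a c), integral_sub h1 (hi a d), integral_sub (hi b d) (hi b c)]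
  simp only [h.integral_mul hH0 hH hlam, h.covFun_eq hH0 hH hlam]

end IsStationaryFOU

/-! ### Smoothness, convexity and the correlation of increments -/

theorem contDiffOn_two_fouCov {lam a : ℝ} (hlam : 0 < lam) (ha0 : 0 < a) (ha1 : a < 1) (κ : ℝ) :
    ContDiffOn ℝ 2 (fun t => κ * fouCov lam a t) (Ioi 0) := by
  rw [show (2 : WithTop ℕ∞) = 1 + 1 by norm_num, contDiffOn_succ_iff_deriv_of_isOpen isOpen_Ioi]
  have h1 : ∀ t ∈ Ioi (0 : ℝ), HasDerivAt (fun t => κ * fouCov lam a t) (κ * fouCovDeriv lam a t) t :=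
    fun t ht => (hasDerivAt_fouCov hlam ha0 ha1 ht).const_mul κ
  have h2 : ∀ t ∈ Ioi (0 : ℝ), HasDerivAt (fun t => κ * fouCovDeriv lam a t)
      (κ * fouCovDeriv2 lam a t) t :=
    fun t ht => (hasDerivAt_fouCovDeriv hlam ha0 ha1 ht).const_mul κ
  refine ⟨fun t ht => (h1 t ht).differentiableAt.differentiableWithinAt, by simp, ?_⟩
  refine ContDiffOn.congr ?_ fun t ht => (h1 t ht).deriv
  rw [show (1 : WithTop ℕ∞) = 0 + 1 by norm_num, contDiffOn_succ_iff_deriv_of_isOpen isOpen_Ioi]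
  refine ⟨fun t ht => (h2 t ht).differentiableAt.differentiableWithinAt, by simp, ?_⟩
  exact contDiffOn_zero.2 (((continuousOn_fouCovDeriv2 hlam ha0 ha1).const_smul κ).congr
    fun t ht => (h2 t ht).deriv)

theorem iteratedDeriv_two_fouCov {lam a : ℝ} (hlam : 0 < lam) (ha0 : 0 < a) (ha1 : a < 1) (κ : ℝ)
    {t : ℝ} (ht : 0 < t) :
    iteratedDeriv 2 (fun t => κ * fouCov lam a t) t = κ * fouCovDeriv2 lam a t := by
  rw [iteratedDeriv_succ, iteratedDeriv_one]
  refine HasDerivAt.deriv ?_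
  refine ((hasDerivAt_fouCovDeriv hlam ha0 ha1 ht).const_mul κ).congr_of_eventuallyEq ?_
  filter_upwards [lt_mem_nhds ht] with s hs
  exact ((hasDerivAt_fouCov hlam ha0 ha1 hs).const_mul κ).deriv

/-- The points `y` and `z` are convex combinations of `x` and `w` with swapped weights, so the two
convexity inequalities add up. -/
theorem ConvexOn.add_le_add_of_add_eq {s : Set ℝ} {f : ℝ → ℝ} (hf : ConvexOn ℝ s f)
    {x y z w : ℝ} (hx : x ∈ s) (hw : w ∈ s) (hxy : x ≤ y) (hyw : y ≤ w) (h : x + w = y + z) :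
    f y + f z ≤ f x + f w := by
  rcases (hxy.trans hyw).eq_or_lt with hxw | hxw
  · obtain rfl : x = y := by linarith
    obtain rfl : w = z := by linarith
    exact le_rfl
  · have hp : 0 < w - x := by linarith
    have e : (w - y) / (w - x) + (y - x) / (w - x) = 1 := by field_simp; ring
    have e' : (y - x) / (w - x) + (w - y) / (w - x) = 1 := by field_simp; ring
    have p1 : 0 ≤ (w - y) / (w - x) := div_nonneg (by linarith) hp.le
    have p2 : 0 ≤ (y - x) / (w - x) := div_nonneg (by linarith) hp.le
    have h1 := hf.2 hx hw p1 p2 e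
    have h2 := hf.2 hx hw p2 p1 e'
    simp only [smul_eq_mul] at h1 h2
    rw [show (w - y) / (w - x) * x + (y - x) / (w - x) * w = y by field_simp; ring] at h1
    rw [show (y - x) / (w - x) * x + (w - y) / (w - x) * w = z by
      rw [show z = x + w - y by linarith]; field_simp; ring] at h2
    linear_combination h1 + h2 + (f x + f w) * e

theorem ConcaveOn.add_le_add_of_add_eq {s : Set ℝ} {f : ℝ → ℝ} (hf : ConcaveOn ℝ s f)
    {x y z w : ℝ} (hx : x ∈ s) (hw : w ∈ s) (hxy : x ≤ y) (hyw : y ≤ w) (h : x + w = y + z) :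
    f x + f w ≤ f y + f z := by
  have := hf.neg.add_le_add_of_add_eq hx hw hxy hyw h
  simp only [Pi.neg_apply] at this
  linarith

namespace IsThresholdPair

theorem iteratedDeriv_two_eq (r : ℝ → ℝ) (t : ℝ) : deriv^[2] r t = iteratedDeriv 2 r t := by
  rw [iteratedDeriv_eq_iterate]

variable {r : ℝ → ℝ} {T₀ T₁ : ℝ}

/-- Continuity at `0` extends convexity to the closed interval; this is needed for adjacent
increments, where `c - b = 0`. -/
theorem convexOn (h : IsThresholdPair r T₀ T₁) (hc : Continuous r)
    (hr : ContDiffOn ℝ 2 r (Ioi 0)) : ConvexOn ℝ (Icc 0 T₀) r := by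
  obtain ⟨h1, -, h2⟩ := (contDiffOn_succ_iff_deriv_of_isOpen (n := 1) isOpen_Ioi).1
    (by simpa [one_add_one_eq_two] using hr)
  have hsub : interior (Icc 0 T₀) ⊆ Ioi 0 := by
    rw [interior_Icc]; exact fun t ht => ht.1
  refine convexOn_of_deriv2_nonneg (convex_Icc 0 T₀) hc.continuousOn (h1.mono hsub)
    ((h2.differentiableOn (by norm_num)).mono hsub) fun t ht => ?_
  rw [interior_Icc] at ht
  rw [iteratedDeriv_two_eq]
  exact (h.deriv2_pos t ht).le

theorem concaveOn (h : IsThresholdPair r T₀ T₁) (hc : Continuous r)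
    (hr : ContDiffOn ℝ 2 r (Ioi 0)) : ConcaveOn ℝ (Ioi T₁) r := by
  obtain ⟨h1, -, h2⟩ := (contDiffOn_succ_iff_deriv_of_isOpen (n := 1) isOpen_Ioi).1
    (by simpa [one_add_one_eq_two] using hr)
  have hsub : interior (Ioi T₁) ⊆ Ioi 0 := by
    rw [interior_Ioi]; exact Ioi_subset_Ioi (h.pos.trans h.lt).le
  refine concaveOn_of_deriv2_nonpos (convex_Ioi T₁) hc.continuousOn (h1.mono hsub)
    ((h2.differentiableOn (by norm_num)).mono hsub) fun t ht => ?_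
  rw [interior_Ioi] at ht
  rw [iteratedDeriv_two_eq]
  exact (h.deriv2_neg t ht).le

end IsThresholdPair

theorem mainTheorem8 (H lam σ : ℝ) (hH0 : 0 < H) (hH : H < 1 / 2) (hlam : 0 < lam) (hσ : σ ≠ 0) :
    -- thresholds exist, and depend on `H`, `lam`, `σ` only
    (∃ T₀ T₁ : ℝ, ∀ (Ω : Type u) [MeasurableSpace Ω] (P : Measure Ω) [IsProbabilityMeasure P]
      (B X : ℝ → Ω → ℝ), IsStationaryFOU H lam σ B X P →
        ContDiffOn ℝ 2 (covFun X P) (Ioi 0) ∧ IsThresholdPair (covFun X P) T₀ T₁) ∧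
    -- all such thresholds have the two correlation properties
    (∀ (Ω : Type u) [MeasurableSpace Ω] (P : Measure Ω) [IsProbabilityMeasure P]
      (B X : ℝ → Ω → ℝ), IsStationaryFOU H lam σ B X P →
      ∀ T₀ T₁ : ℝ, IsThresholdPair (covFun X P) T₀ T₁ →
        (∀ s₀ a b c d : ℝ, s₀ ≤ a → a < b → b ≤ c → c < d → d ≤ s₀ + T₀ →
          Integrable (fun ω => (X b ω - X a ω) * (X d ω - X c ω)) P ∧
          ∫ ω, (X b ω - X a ω) * (X d ω - X c ω) ∂P ≤ 0) ∧
        (∀ a b c d : ℝ, a < b → b < c → c < d → T₁ < c - b →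
          Integrable (fun ω => (X b ω - X a ω) * (X d ω - X c ω)) P ∧
          0 ≤ ∫ ω, (X b ω - X a ω) * (X d ω - X c ω) ∂P)) := by
  have ha0 : 0 < 2 * H := by linarith
  have ha1 : 2 * H < 1 := by linarith
  have hσ2 : 0 < σ ^ 2 := by positivity
  constructor
  · obtain ⟨T₀, T₁, h0, h01, hz, hp, hn⟩ := exists_fouCovDeriv2_thresholds hlam ha0 ha1
    have hd := fun {t : ℝ} (ht : 0 < t) => iteratedDeriv_two_fouCov hlam ha0 ha1 (σ ^ 2) ht
    refine ⟨T₀, T₁, fun Ω _ P _ B X h => ?_⟩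
    rw [h.covFun_eq hH0 hH hlam]
    refine ⟨contDiffOn_two_fouCov hlam ha0 ha1 _, h0, h01, ?_, fun t ht => ?_, fun t ht => ?_⟩
    · rw [hd h0, hz, mul_zero]
    · rw [hd ht.1]
      exact mul_pos hσ2 (hp t ht)
    · rw [hd (h0.trans (h01.trans ht))]
      exact mul_neg_of_pos_of_neg hσ2 (hn t ht)
  · intro Ω _ P _ B X h T₀ T₁ hT
    have hcov := h.covFun_eq hH0 hH hlam
    have hc : Continuous (covFun X P) := by
      rw [hcov]
      exact continuous_const.mul (continuous_fouCov hlam ha0.le ha1.le)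
    have hr : ContDiffOn ℝ 2 (covFun X P) (Ioi 0) := by
      rw [hcov]
      exact contDiffOn_two_fouCov hlam ha0 ha1 _
    constructor
    · intro s₀ a b c d h1 h2 h3 h4 h5
      obtain ⟨hi, e⟩ := h.integral_increments hH0 hH hlam a b c d
      refine ⟨hi, ?_⟩
      -- The outer pair is `c - b`, `d - a`, the shortest and longest lags; `d - a ≤ T₀` because all
      -- four times lie in `[s₀, s₀ + T₀]`.
      have := (hT.convexOn hc hr).add_le_add_of_add_eq (x := c - b) (y := d - b) (z := c - a)
        (w := d - a) ⟨by linarith, by linarith⟩ ⟨by linarith, by linarith⟩ (by linarith)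
        (by linarith) (by ring)
      linarith
    · intro a b c d h1 h2 h3 h4
      obtain ⟨hi, e⟩ := h.integral_increments hH0 hH hlam a b c d
      refine ⟨hi, ?_⟩
      have := (hT.concaveOn hc hr).add_le_add_of_add_eq (x := c - b) (y := d - b) (z := c - a)
        (w := d - a) h4 (mem_Ioi.2 (by linarith)) (by linarith)
        (by linarith) (by ring)
      linarith
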